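/- Let $\mathbb{k}$ be a field, $n\ge 0$, $S=\mathbb{k}[x_1,\dots,x_n]$, and let $K=K(x_1,\dots,x_n)$ be the Koszul complex: $K_d$ is the free $S$-module $S(-d)^{\binom nd}$ with basis $e_T$, $T\subseteq\{1,\dots,n\}$, $|T|=d$, and $\partial e_T=\sum_{j=1}^{d}(-1)^j x_{i_j}e_{T\setminus\{i_j\}}$ for $T=\{i_1<\dots<i_d\}$. A subcomplex of $K$ is a complex $F=(F_i)_{i\ge0}$ of free $S$-modules together with a chain map $\varphi:F\to K$ such that every $\varphi_i:F_i\to K_i$ is split injective; its rank sequence is $(\operatorname{rank}F_0,\operatorname{rank}F_1,\dots)$. For integers $a,i\ge 1$ write the Macaulay expansion $a=\binom{a_i}{i}+\binom{a_{i-1}}{i-1}+\dots+\binom{a_j}{j}$ with $a_i>a_{i-1}>\dots>a_j\ge j\ge 1$ (it exists and is unique), and put $a^{(i)}=\binom{a_i}{i+1}+\binom{a_{i-1}}{i}+\dots+\binom{a_j}{j+1}$; put $0^{(i)}=0$. **Theorem.** A sequence $(r_0,\dots,r_n)$ of non-negative integers is the rank sequence of a subcomplex of $K(x_1,\dots,x_n)$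 if and only if it is the zero sequence, or $r_0=1$, $r_1\le n$ (when $n\ge 1$) and $$0\le r_{i+1}\le r_i^{(i)}\quad\text{for } 1\le i\le n-1 .$$ The same characterization holds for the rank sequences of graded subcomplexes, that is, those in which every $F_i$ is a graded free module and every $\varphi_i$ is homogeneous of degree $0$. -/

import Mathlib

open CategoryTheory Finset

universe u v

/-! ### Macaulay expansions -/

/-- `a = C(c_i, i) + C(c_{i-1}, i-1) + ⋯ + C(c_j, j)` with `c_i > c_{i-1} > ⋯ > c_j ≥ j ≥ 1`,
where `c_l` is written `c l`. -/
structure IsMacaulayExpansion (a i j : ℕ) (c : ℕ → ℕ) : Prop where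
  one_le : 1 ≤ j
  le : j ≤ i
  le_apply : j ≤ c j
  lt_succ : ∀ l, j ≤ l → l < i → c l < c (l + 1)
  eq_sum : a = ∑ l ∈ Icc j i, (c l).choose l

theorem IsMacaulayExpansion.le_apply' {a i j : ℕ} {c : ℕ → ℕ} (h : IsMacaulayExpansion a i j c)
    (l : ℕ) (hjl : j ≤ l) (hli : l ≤ i) : l ≤ c l := by
  induction l, hjl using Nat.le_induction with
  | base => exact h.le_apply
  | succ l hl ih =>
    have h1 := h.lt_succ l hl (by omega)
    have h2 := ih (by omega)
    omega

theorem IsMacaulayExpansion.pos {a i j : ℕ} {c : ℕ → ℕ} (h : IsMacaulayExpansion a i j c) :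
    0 < a := by
  rw [h.eq_sum]
  exact Finset.sum_pos' (fun _ _ => Nat.zero_le _)
    ⟨j, Finset.mem_Icc.2 ⟨le_rfl, h.le⟩, Nat.choose_pos h.le_apply⟩

/-- Removing the leading term. -/
theorem IsMacaulayExpansion.tail {a i j : ℕ} {c : ℕ → ℕ}
    (h : IsMacaulayExpansion a (i + 1) j c) (hj : j ≤ i) :
    IsMacaulayExpansion (∑ l ∈ Icc j i, (c l).choose l) i j c :=
  ⟨h.one_le, hj, h.le_apply, fun l h1 h2 => h.lt_succ l h1 (by omega), rfl⟩

theorem IsMacaulayExpansion.lt_choose {a i j : ℕ} {c : ℕ → ℕ} (h : IsMacaulayExpansion a i j c) :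
    a < (c i + 1).choose i := by
  induction i generalizing a with
  | zero => have := h.one_le; have := h.le; omega
  | succ i ih =>
    rw [Nat.choose_succ_succ', h.eq_sum]
    rcases Nat.lt_or_ge i j with hj | hj
    · have hj' : j = i + 1 := le_antisymm h.le hj
      subst hj'
      have h1 : 0 < (c (i + 1)).choose i := Nat.choose_pos (by have := h.le_apply; omega)
      simp only [Finset.Icc_self, Finset.sum_singleton]
      omega
    · rw [Finset.sum_Icc_succ_top (by omega)]
      have h1 := ih (h.tail hj)
      have h2 : (c i + 1).choose i ≤ (c (i + 1)).choose i :=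
        Nat.choose_le_choose _ (h.lt_succ i hj (by omega))
      omega

theorem IsMacaulayExpansion.choose_le {a i j : ℕ} {c : ℕ → ℕ} (h : IsMacaulayExpansion a i j c) :
    (c i).choose i ≤ a := by
  rw [h.eq_sum]
  exact Finset.single_le_sum (f := fun l => (c l).choose l) (fun _ _ => Nat.zero_le _)
    (Finset.mem_Icc.2 ⟨h.le, le_rfl⟩)

/-- The Macaulay expansion is unique. -/
theorem IsMacaulayExpansion.unique {a i j j' : ℕ} {c c' : ℕ → ℕ}
    (h : IsMacaulayExpansion a i j c) (h' : IsMacaulayExpansion a i j' c') :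
    j = j' ∧ ∀ l, j ≤ l → l ≤ i → c l = c' l := by
  induction i generalizing a with
  | zero => have := h.one_le; have := h.le; omega
  | succ i ih =>
    have key : ∀ {j j' : ℕ} {c c' : ℕ → ℕ}, IsMacaulayExpansion a (i + 1) j c →
        IsMacaulayExpansion a (i + 1) j' c' → c (i + 1) ≤ c' (i + 1) := by
      intro j j' c c' h h'
      by_contra hlt
      have h1 : (c' (i + 1) + 1).choose (i + 1) ≤ (c (i + 1)).choose (i + 1) :=
        Nat.choose_le_choose _ (by omega)
      have h2 := h.choose_le
      have h3 := h'.lt_choose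
      omega
    have htop : c (i + 1) = c' (i + 1) := le_antisymm (key h h') (key h' h)
    have e := h.eq_sum
    have e' := h'.eq_sum
    rcases Nat.lt_or_ge i j with hj | hj
    · have hji : j = i + 1 := le_antisymm h.le hj
      subst hji
      rcases Nat.lt_or_ge i j' with hj' | hj'
      · have hji' : j' = i + 1 := le_antisymm h'.le hj'
        subst hji'
        refine ⟨rfl, fun l h1 h2 => ?_⟩
        obtain rfl : l = i + 1 := by omega
        exact htop
      · rw [Finset.sum_Icc_succ_top (by omega)] at e'
        have := (h'.tail hj').pos
        simp only [Finset.Icc_self, Finset.sum_singleton, htop] at e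
        omega
    · rw [Finset.sum_Icc_succ_top (by omega), htop] at e
      rcases Nat.lt_or_ge i j' with hj' | hj'
      · have hji' : j' = i + 1 := le_antisymm h'.le hj'
        subst hji'
        have := (h.tail hj).pos
        simp only [Finset.Icc_self, Finset.sum_singleton] at e'
        omega
      · rw [Finset.sum_Icc_succ_top (by omega)] at e'
        have hs : ∑ l ∈ Icc j' i, (c' l).choose l = ∑ l ∈ Icc j i, (c l).choose l := by omega
        have t' := h'.tail hj'
        rw [hs] at t'
        obtain ⟨h1, h2⟩ := ih (h.tail hj) t'
        refine ⟨h1, fun l hl hl' => ?_⟩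
        rcases Nat.lt_or_ge i l with h3 | h3
        · obtain rfl : l = i + 1 := by omega
          exact htop
        · exact h2 l hl h3

/-- Every positive integer has a Macaulay expansion for every `i ≥ 1`. -/
theorem exists_isMacaulayExpansion (a i : ℕ) (ha : 0 < a) (hi : 1 ≤ i) :
    ∃ (j : ℕ) (c : ℕ → ℕ), IsMacaulayExpansion a i j c := by
  induction i, hi using Nat.le_induction generalizing a with
  | base => exact ⟨1, fun _ => a, le_rfl, le_rfl, ha, fun l h1 h2 => by omega, by simp⟩
  | succ i hi ih =>
    have hlt : ∀ b : ℕ, b < (b + i + 1).choose (i + 1) := by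
      intro b
      induction b with
      | zero => simp
      | succ b hb =>
        have h1 : (b + 1 + i + 1).choose (i + 1) =
            (b + i + 1).choose i + (b + i + 1).choose (i + 1) := by
          rw [show b + 1 + i + 1 = (b + i + 1) + 1 by ring, Nat.choose_succ_succ']
        have h2 : 0 < (b + i + 1).choose i := Nat.choose_pos (by omega)
        omega
    have hex : ∃ m, a < (m + 1).choose (i + 1) := ⟨a + i, hlt a⟩
    classical
    obtain ⟨m, hm1, hmin⟩ : ∃ m, a < (m + 1).choose (i + 1) ∧
        ∀ m' < m, ¬ a < (m' + 1).choose (i + 1) :=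
      ⟨Nat.find hex, Nat.find_spec hex, fun _ h => Nat.find_min hex h⟩
    have him : i ≤ m := by
      by_contra h
      rw [Nat.choose_eq_zero_of_lt (by omega)] at hm1
      omega
    have hm2 : m.choose (i + 1) ≤ a := by
      rcases Nat.eq_zero_or_pos m with h0 | h0
      · rw [h0, Nat.choose_zero_succ]
        exact Nat.zero_le _
      · have := hmin (m - 1) (by omega)
        rw [Nat.sub_add_cancel h0] at this
        omega
    have him' : i + 1 ≤ m := by
      by_contra h
      obtain rfl : i = m := by omega
      rw [Nat.choose_self] at hm1
      omega
    rcases Nat.eq_or_lt_of_le hm2 with h | h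
    · exact ⟨i + 1, fun _ => m, by omega, le_rfl, him', fun l h1 h2 => by omega, by simp [h]⟩
    · obtain ⟨j, c, hc⟩ := ih (a - m.choose (i + 1)) (by omega)
      have hci : c i < m := by
        by_contra hge
        have h1 := hc.choose_le
        have h2 : m.choose i ≤ (c i).choose i := Nat.choose_le_choose _ (by omega)
        rw [Nat.choose_succ_succ'] at hm1
        omega
      have hne : ∀ l, l ≤ i → (if l = i + 1 then m else c l) = c l := fun l hl =>
        if_neg (by omega)
      have hji := hc.le
      refine ⟨j, fun l => if l = i + 1 then m else c l, hc.one_le, by omega, ?_, ?_, ?_⟩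
      · rw [hne j hji]
        exact hc.le_apply
      · intro l h1 h2
        rw [hne l (by omega)]
        rcases Nat.eq_or_lt_of_le (Nat.lt_succ_iff.1 h2) with h3 | h3
        · subst h3
          rw [if_pos rfl]
          exact hci
        · rw [hne (l + 1) (by omega)]
          exact hc.lt_succ l h1 h3
      · rw [Finset.sum_Icc_succ_top (by omega), if_pos rfl]
        have hs : ∑ l ∈ Icc j i, (if l = i + 1 then m else c l).choose l =
            ∑ l ∈ Icc j i, (c l).choose l :=
          Finset.sum_congr rfl fun l hl => by rw [hne l (Finset.mem_Icc.1 hl).2]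
        rw [hs, ← hc.eq_sum]
        omega

/-- The shifted expansion `a^{(i)} = C(c_i, i+1) + C(c_{i-1}, i) + ⋯ + C(c_j, j+1)`, where
`c_i, …, c_j` is the Macaulay expansion of `a`. For `a = 0` there is no expansion and
`0^{(i)} = 0`. -/
noncomputable def macaulayShift (a i : ℕ) : ℕ :=
  open Classical in
  if h : ∃ p : ℕ × (ℕ → ℕ), IsMacaulayExpansion a i p.1 p.2 then
    ∑ l ∈ Icc h.choose.1 i, (h.choose.2 l).choose (l + 1)
  else 0

theorem IsMacaulayExpansion.macaulayShift_eq {a i j : ℕ} {c : ℕ → ℕ}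
    (h : IsMacaulayExpansion a i j c) :
    macaulayShift a i = ∑ l ∈ Icc j i, (c l).choose (l + 1) := by
  have hex : ∃ p : ℕ × (ℕ → ℕ), IsMacaulayExpansion a i p.1 p.2 := ⟨(j, c), h⟩
  rw [macaulayShift, dif_pos hex]
  obtain ⟨h1, h2⟩ := h.unique hex.choose_spec
  rw [← h1]
  refine Finset.sum_congr rfl fun l hl => ?_
  rw [Finset.mem_Icc] at hl
  rw [h2 l hl.1 hl.2]

theorem macaulayShift_zero (i : ℕ) : macaulayShift 0 i = 0 := by
  rw [macaulayShift, dif_neg]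
  rintro ⟨p, hp⟩
  exact lt_irrefl _ hp.pos

/-! ### The Koszul complex -/

section Koszul

variable {R : Type u} [CommRing R] {m : ℕ}

/-- The position (counted from `1`) of an element `a ∈ T` in the increasing enumeration of `T`. -/
def position (T : Finset (Fin m)) (a : Fin m) : ℕ := #{b ∈ T | b ≤ a}

/-- The free module `K_d` with basis `e_T`, `T` running over the `d`-element subsets. -/
abbrev KoszulModule (R : Type u) [CommRing R] (m d : ℕ) : Type u :=
  {T : Finset (Fin m) // #T = d} →₀ R

/-- The subset `T ∖ {a}`. -/
def eraseSubset {d : ℕ} (T : {T : Finset (Fin m) // #T = d + 1}) (a : T.1) :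
    {T : Finset (Fin m) // #T = d} :=
  ⟨T.1.erase a, by rw [Finset.card_erase_of_mem a.2, T.2, Nat.add_sub_cancel]⟩

/-- The Koszul differential: if `T = {i_1 < ⋯ < i_{d+1}}` then
`∂ e_T = ∑_j (-1)^j f_{i_j} e_{T ∖ i_j}`. -/
noncomputable def koszulD (f : Fin m → R) (d : ℕ) :
    KoszulModule R m (d + 1) →ₗ[R] KoszulModule R m d :=
  Finsupp.linearCombination R fun T =>
    ∑ a : T.1, Finsupp.single (eraseSubset T a) ((-1) ^ position T.1 a * f a)

/-- The same differential on all subsets at once; only used to verify `∂ ∘ ∂ = 0`. -/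
noncomputable def koszulTotalD (f : Fin m → R) :
    (Finset (Fin m) →₀ R) →ₗ[R] (Finset (Fin m) →₀ R) :=
  Finsupp.linearCombination R fun T =>
    ∑ a ∈ T, Finsupp.single (T.erase a) ((-1) ^ position T a * f a)

theorem position_erase_of_lt {T : Finset (Fin m)} {a b : Fin m} (hab : a < b) :
    position (T.erase b) a = position T a := by
  unfold position
  congr 1
  ext x
  simp only [Finset.mem_filter, Finset.mem_erase]
  constructor
  · rintro ⟨⟨_, h⟩, h'⟩; exact ⟨h, h'⟩
  · rintro ⟨h, h'⟩; exact ⟨⟨(lt_of_le_of_lt h' hab).ne, h⟩, h'⟩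

theorem position_erase_of_gt {T : Finset (Fin m)} {a b : Fin m} (hab : a < b) (ha : a ∈ T) :
    position (T.erase a) b + 1 = position T b := by
  unfold position
  rw [Finset.filter_erase, Finset.card_erase_add_one]
  exact Finset.mem_filter.2 ⟨ha, hab.le⟩

theorem koszulTotalD_comp (f : Fin m → R) : koszulTotalD f ∘ₗ koszulTotalD f = 0 := by
  ext1 T
  ext1
  simp only [koszulTotalD, LinearMap.comp_apply, Finsupp.lsingle_apply,
    Finsupp.linearCombination_single, one_smul, map_sum, LinearMap.zero_apply, Finset.smul_sum,
    Finsupp.smul_single, smul_eq_mul]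
  rw [Finset.sum_sigma']
  refine Finset.sum_involution (fun p _ => ⟨p.2, p.1⟩) ?_ ?_ ?_ ?_
  · rintro ⟨a, b⟩ h
    simp only [Finset.mem_sigma, Finset.mem_erase] at h
    obtain ⟨ha, hba, hb⟩ := h
    simp only
    rw [Finset.erase_right_comm, ← Finsupp.single_add]
    refine (congrArg _ ?_).trans (Finsupp.single_zero _)
    rcases lt_or_gt_of_ne hba with h | h
    · rw [position_erase_of_lt h, ← position_erase_of_gt h hb]
      ring
    · rw [position_erase_of_lt h, ← position_erase_of_gt h ha]
      ring
  · rintro ⟨a, b⟩ h _ he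
    simp only [Finset.mem_sigma, Finset.mem_erase] at h
    simp only [Sigma.mk.injEq] at he
    exact h.2.1 he.1
  · rintro ⟨a, b⟩ h
    simp only [Finset.mem_sigma, Finset.mem_erase] at h ⊢
    exact ⟨h.2.2, h.2.1.symm, h.1⟩
  · rintro ⟨a, b⟩ _
    rfl

theorem mapDomain_koszulD (f : Fin m → R) (d : ℕ) (z : KoszulModule R m (d + 1)) :
    Finsupp.mapDomain Subtype.val (koszulD f d z) =
      koszulTotalD f (Finsupp.mapDomain Subtype.val z) := by
  suffices h : Finsupp.lmapDomain R R Subtype.val ∘ₗ koszulD f d =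
      koszulTotalD f ∘ₗ Finsupp.lmapDomain R R Subtype.val from LinearMap.congr_fun h z
  ext1 T
  ext1
  simp only [koszulD, koszulTotalD, LinearMap.comp_apply, Finsupp.lsingle_apply,
    Finsupp.linearCombination_single, one_smul, map_sum, Finsupp.lmapDomain_apply,
    Finsupp.mapDomain_single]
  exact Finset.sum_coe_sort T.1 fun a => Finsupp.single (T.1.erase a) ((-1) ^ position T.1 a * f a)

theorem koszulD_comp (f : Fin m → R) (d : ℕ) : koszulD f d ∘ₗ koszulD f (d + 1) = 0 := by
  refine LinearMap.ext fun z => Finsupp.mapDomain_injective Subtype.val_injective ?_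
  rw [LinearMap.comp_apply, mapDomain_koszulD, mapDomain_koszulD, LinearMap.zero_apply,
    Finsupp.mapDomain_zero]
  exact LinearMap.congr_fun (koszulTotalD_comp f) _

/-- The Koszul complex `K(f_1, …, f_m)`. -/
noncomputable def koszulComplex (f : Fin m → R) : ChainComplex (ModuleCat.{u} R) ℕ :=
  ChainComplex.of (fun d => ModuleCat.of R (KoszulModule R m d))
    (fun d => ModuleCat.ofHom (koszulD f d))
    (fun d => by rw [← ModuleCat.ofHom_comp, koszulD_comp]; rfl)

theorem koszulComplex_d (f : Fin m → R) (d : ℕ) :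
    (koszulComplex f).d (d + 1) d = ModuleCat.ofHom (koszulD f d) :=
  ChainComplex.of_d (fun d => ModuleCat.of R (KoszulModule R m d))
    (fun d => ModuleCat.ofHom (koszulD f d)) d

end Koszul

/-! ### Subcomplexes and rank sequences -/

section Subcomplex

variable {R : Type u} [CommRing R]

/-- `F` is a complex of free modules and `φ : F ⟶ G` is a chain map that is split injective in
every degree. -/
structure IsSubcomplexVia {F G : ChainComplex (ModuleCat.{v} R) ℕ} (φ : F ⟶ G) : Prop where
  free : ∀ i, Module.Free R (F.X i)
  split : ∀ i, ∃ σ : G.X i ⟶ F.X i, φ.f i ≫ σ = 𝟙 (F.X i)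

/-- `r_i` is the rank of the free module `F_i` for every `i`. -/
def IsRankSequence (F : ChainComplex (ModuleCat.{v} R) ℕ) (r : ℕ → ℕ) : Prop :=
  ∀ i, Module.rank R (F.X i) = r i

/-- The set `RS(G)` of the rank sequences of subcomplexes of `G`. -/
def RS (G : ChainComplex (ModuleCat.{v} R) ℕ) : Set (ℕ → ℕ) :=
  {r | ∃ (F : ChainComplex (ModuleCat.{v} R) ℕ) (φ : F ⟶ G),
    IsSubcomplexVia φ ∧ IsRankSequence F r}

end Subcomplex

/-! ### The Koszul complex on the variables, and its grading -/

section Variables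

/-- The Koszul complex `K(x_1, …, x_n)` over `S = k[x_1, …, x_n]`. -/
noncomputable abbrev koszulVariables (k : Type u) [Field k] (n : ℕ) :
    ChainComplex (ModuleCat.{u} (MvPolynomial (Fin n) k)) ℕ :=
  koszulComplex (fun i : Fin n => (MvPolynomial.X i : MvPolynomial (Fin n) k))

variable {k : Type u} [Field k] {n : ℕ}

/-- `z ∈ K_d = S(-d)^{C(n,d)}` is homogeneous of degree `e`: its coordinates are forms of
degree `e - d` (and `z = 0` if `e < d`). -/
def IsKoszulHomogeneous {d : ℕ} (z : KoszulModule (MvPolynomial (Fin n) k) n d) (e : ℕ) : Prop :=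
  ∀ T, z T ≠ 0 → ∃ c, c + d = e ∧ (z T).IsHomogeneous c

/-- Every `F_i` is a graded free module `⨁_j S(-a_j)` such that `φ_i` is homogeneous of degree
zero, that is, some basis `b_j` of `F_i` has `φ_i (b_j)` homogeneous of degree `a_j`. As `φ_i` is
injective, the differential of `F` is then homogeneous of degree zero too. -/
def IsGradedVia {F : ChainComplex (ModuleCat.{u} (MvPolynomial (Fin n) k)) ℕ}
    (φ : F ⟶ koszulVariables k n) : Prop :=
  ∀ i, ∃ (J : Type) (b : Module.Basis J (MvPolynomial (Fin n) k) (F.X i)) (a : J → ℕ),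
    ∀ j, IsKoszulHomogeneous (d := i) ((φ.f i).hom (b j)) (a j)

/-- The rank sequences of graded subcomplexes of `K(x_1, …, x_n)`. -/
def gradedKoszulRS (k : Type u) [Field k] (n : ℕ) : Set (ℕ → ℕ) :=
  {r | ∃ (F : ChainComplex (ModuleCat.{u} (MvPolynomial (Fin n) k)) ℕ)
    (φ : F ⟶ koszulVariables k n),
    IsSubcomplexVia φ ∧ IsGradedVia φ ∧ IsRankSequence F r}

end Variables

/-!
The characterization reduces to the Kruskal–Katona theorem: the rank sequences of subcomplexes of
`K(x_1, …, x_n)` are exactly the face-counting sequences of simplicial complexes on `{1, …, n}`,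
the void complex giving the zero sequence.

A simplicial complex `Δ` yields the graded subcomplex spanned by the `e_T` with `T ∈ Δ`
(`mem_gradedKoszulRS_of_simplicialComplex`).

Conversely, let `φ : F → K` be a subcomplex and let `W_d` be the image of `F_d` in
`K_d / (x_1, …, x_n) K_d`, the `d`-th exterior power of `k^n`. As `φ` splits, `dim W_d = rank F_d`
(`rank_reducedRange`). Comparing the linear parts of the two sides of `∂ φ = φ ∂` shows that
contraction with each dual vector maps `W_{d+1}` into `W_d` (`koszulD_single_mem_reducedRange`).
Contraction with the dual vector of `e_x` removes `x` from the colexicographically leading set of an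
element whose leading set contains `x` (`IsLeadingSet.koszulD_single`), so the leading sets of the
spaces `W_d` form a simplicial complex, and it has `dim W_d` faces of size `d`
(`card_leadingSets`).

The passage between Mathlib's form of the Kruskal–Katona theorem, which concerns shadows of
colexicographic initial segments, and the function `a ↦ a^{(i)}` is
`exists_isInitSeg_upperShadow`: if `a` has the expansion `∑ C(c_l, l)` and `A = {c_j, …, c_i}`, then
exactly `∑ C(c_l, l + s)` sets of size `i + s` precede `A`, and a set of size `i + 1` precedes `A`
iff all its `i`-element subsets do.
-/

/-! ### Initial segments of the colexicographic order and their upper shadows -/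

section Colex

variable {n : ℕ}

/-- The `m`-element subsets of `Fin n` that strictly precede `A` in the colexicographic order.
The set `A` need not have `m` elements. -/
def colexBelow (A : Finset (Fin n)) (m : ℕ) : Finset (Finset (Fin n)) :=
  {T | #T = m ∧ toColex T < toColex A}

theorem mem_colexBelow {A T : Finset (Fin n)} {m : ℕ} :
    T ∈ colexBelow A m ↔ #T = m ∧ toColex T < toColex A := by
  simp [colexBelow]

theorem isInitSeg_colexBelow (A : Finset (Fin n)) (m : ℕ) :
    Colex.IsInitSeg (colexBelow A m) m := by
  refine ⟨fun T hT => (mem_colexBelow.1 hT).1, fun T U hT hU => ?_⟩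
  exact mem_colexBelow.2 ⟨hU.2, hU.1.trans (mem_colexBelow.1 hT).2⟩

/-- If `x` exceeds every element of `B`, then a set precedes `B ∪ {x}` iff it lies below `x`, or it
is `T ∪ {x}` with `T` preceding `B`. -/
theorem card_colexBelow_insert {B : Finset (Fin n)} {x : Fin n} (hx : ∀ b ∈ B, b < x) (m : ℕ) :
    #(colexBelow (insert x B) (m + 1)) = (x : ℕ).choose (m + 1) + #(colexBelow B m) := by
  have hxB : x ∉ B := fun h => lt_irrefl _ (hx x h)
  have key : colexBelow (insert x B) (m + 1) =
      (Finset.Iio x).powersetCard (m + 1) ∪ (colexBelow B m).image (insert x) := by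
    ext T
    simp only [mem_union, mem_colexBelow, mem_powersetCard, mem_image]
    constructor
    · rintro ⟨hT, hlt⟩
      have hle : ∀ b ∈ T, b ≤ x := Colex.forall_le_mono hlt.le (by
        intro b hb
        rcases mem_insert.1 hb with rfl | hb
        · exact le_rfl
        · exact (hx b hb).le)
      by_cases hxT : x ∈ T
      · refine Or.inr ⟨T.erase x, ⟨by rw [card_erase_of_mem hxT, hT, Nat.add_sub_cancel], ?_⟩,
          insert_erase hxT⟩
        have := (Colex.toColex_sdiff_lt_toColex_sdiff (s := T) (t := insert x B) (u := {x})
          (by simpa using hxT) (by simp)).2 hlt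
        rwa [sdiff_singleton_eq_erase, sdiff_singleton_eq_erase, erase_insert hxB] at this
      · refine Or.inl ⟨fun b hb => mem_Iio.2 (lt_of_le_of_ne (hle b hb) ?_), hT⟩
        rintro rfl
        exact hxT hb
    · rintro (⟨hT, hc⟩ | ⟨U, ⟨hU, hlt⟩, rfl⟩)
      · refine ⟨hc, Colex.toColex_lt_toColex_iff_exists_forall_lt.2
          ⟨x, mem_insert_self _ _, fun h => ?_, fun b hb _ => mem_Iio.1 (hT hb)⟩⟩
        exact lt_irrefl _ (mem_Iio.1 (hT h))
      · have hxU : x ∉ U := fun h =>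
          lt_irrefl _ (Colex.forall_lt_mono hlt.le hx x h)
        refine ⟨by rw [card_insert_of_notMem hxU, hU], ?_⟩
        have := Colex.toColex_sdiff_lt_toColex_sdiff (s := insert x U) (t := insert x B) (u := {x})
          (by simp) (by simp)
        rw [sdiff_singleton_eq_erase, sdiff_singleton_eq_erase, erase_insert hxB,
          erase_insert hxU] at this
        exact this.1 hlt
  have hnot : ∀ U ∈ colexBelow B m, x ∉ U := fun U hU h =>
    lt_irrefl _ (Colex.forall_lt_mono (mem_colexBelow.1 hU).2.le hx x h)
  rw [key, card_union_of_disjoint, card_powersetCard, Fin.card_Iio, card_image_of_injOn]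
  · intro U hU V hV h
    have := congrArg (fun W => W.erase x) h
    simpa [erase_insert (hnot U hU), erase_insert (hnot V hV)] using this
  · rw [disjoint_left]
    intro T hT hT'
    obtain ⟨U, _, rfl⟩ := mem_image.1 hT'
    exact lt_irrefl _ (mem_Iio.1 ((mem_powersetCard.1 hT).1 (mem_insert_self x U)))

theorem colexBelow_empty (m : ℕ) : colexBelow (∅ : Finset (Fin n)) m = ∅ := by
  ext T
  simp [mem_colexBelow]

/-- The set `{c_j, …, c_i}`, viewed inside `Fin n`. -/
def macaulaySet (n j i : ℕ) (c : ℕ → ℕ) : Finset (Fin n) :=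
  {x | ∃ l ∈ Icc j i, c l = x}

theorem mem_macaulaySet {j i : ℕ} {c : ℕ → ℕ} {x : Fin n} :
    x ∈ macaulaySet n j i c ↔ ∃ l, (j ≤ l ∧ l ≤ i) ∧ c l = x := by
  simp [macaulaySet]

/-- The numbers of `i`-element and of `(i+1)`-element sets preceding `{c_j < ⋯ < c_i}` are the two
sums in the definition of `macaulayShift`; they are the cases `s = 0` and `s = 1`. -/
theorem card_colexBelow_macaulaySet {j : ℕ} (hj : 1 ≤ j) {c : ℕ → ℕ} (s i : ℕ) (hji : j ≤ i)
    (hc : ∀ l, j ≤ l → l < i → c l < c (l + 1)) (hn : c i < n) :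
    #(colexBelow (macaulaySet n j i c) (i + s)) = ∑ l ∈ Icc j i, (c l).choose (l + s) := by
  induction i, hji using Nat.le_induction with
  | base =>
    have h1 : macaulaySet n j j c = insert ⟨c j, hn⟩ ∅ := by
      ext x
      simp only [mem_macaulaySet, mem_insert, notMem_empty, or_false, Fin.ext_iff]
      constructor
      · rintro ⟨l, hl, h⟩
        obtain rfl : l = j := by omega
        exact h.symm
      · intro h
        exact ⟨j, ⟨le_rfl, le_rfl⟩, h.symm⟩
    obtain ⟨m, hm⟩ : ∃ m, j + s = m + 1 := ⟨j + s - 1, by omega⟩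
    rw [h1, Icc_self, sum_singleton, hm, card_colexBelow_insert (by simp), colexBelow_empty,
      card_empty, add_zero]
  | succ i hji ih =>
    have hlt := hc i hji (by omega)
    have hmono : ∀ l, j ≤ l → l ≤ i → c l ≤ c i := by
      intro l hl hli
      exact Nat.decreasingInduction' (P := fun t => c t ≤ c i)
        (fun t ht1 ht2 h => (hc t (by omega) (by omega)).le.trans h) hli le_rfl
    have h1 : macaulaySet n j (i + 1) c = insert ⟨c (i + 1), hn⟩ (macaulaySet n j i c) := by
      ext x
      simp only [mem_macaulaySet, mem_insert, Fin.ext_iff]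
      constructor
      · rintro ⟨l, hl, h⟩
        rcases Nat.eq_or_lt_of_le hl.2 with rfl | h2
        · exact Or.inl h.symm
        · exact Or.inr ⟨l, ⟨hl.1, by omega⟩, h⟩
      · rintro (h | ⟨l, hl, h⟩)
        · exact ⟨i + 1, ⟨by omega, le_rfl⟩, h.symm⟩
        · exact ⟨l, ⟨hl.1, by omega⟩, h⟩
    rw [h1, show i + 1 + s = (i + s) + 1 by ring, card_colexBelow_insert,
      sum_Icc_succ_top (by omega), ih (fun l h h' => hc l h (by omega)) (by omega), add_comm,
      show i + s + 1 = i + 1 + s by ring]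
    intro b hb
    obtain ⟨l, hl, h⟩ := mem_macaulaySet.1 hb
    rw [Fin.lt_def, ← h]
    exact (hmono l hl.1 hl.2).trans_lt hlt

/-- At most `i - l` elements of `{c_j < ⋯ < c_i}` lie above `c_l`, and `l ≥ j ≥ 1`. -/
theorem card_filter_macaulaySet_lt {j i : ℕ} (hj : 1 ≤ j) {c : ℕ → ℕ}
    (hc : ∀ l, j ≤ l → l < i → c l < c (l + 1)) {w : Fin n} (hw : w ∈ macaulaySet n j i c) :
    #{a ∈ macaulaySet n j i c | w < a} < i := by
  obtain ⟨l, hl, hlw⟩ := mem_macaulaySet.1 hw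
  have hmono : ∀ t, j ≤ t → t ≤ l → c t ≤ c l := by
    intro t ht htl
    exact Nat.decreasingInduction' (P := fun t => c t ≤ c l)
      (fun t ht1 ht2 h => (hc t (by omega) (by omega)).le.trans h) htl le_rfl
  have hsub : ({a ∈ macaulaySet n j i c | w < a}).image (fun a : Fin n => (a : ℕ)) ⊆
      (Ioc l i).image c := by
    intro y hy
    obtain ⟨a, ha, rfl⟩ := mem_image.1 hy
    obtain ⟨ha1, ha2⟩ := mem_filter.1 ha
    obtain ⟨t, ht, hta⟩ := mem_macaulaySet.1 ha1
    refine mem_image.2 ⟨t, mem_Ioc.2 ⟨?_, ht.2⟩, hta⟩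
    by_contra hle
    have := hmono t ht.1 (by omega)
    rw [Fin.lt_def] at ha2
    omega
  have h1 := card_le_card hsub
  rw [card_image_of_injective _ Fin.val_injective] at h1
  have h2 : #((Ioc l i).image c) ≤ #(Ioc l i) := card_image_le
  rw [Nat.card_Ioc] at h2
  omega

/-- An `(i+1)`-element set `T` precedes `{c_j < ⋯ < c_i}` iff all its `i`-element subsets do. For
the converse remove the minimum of `T`: the largest difference to `{c_j < ⋯ < c_i}` is then at some
`c_l` with `l ≥ 1`, below which `l` of the `i` remaining elements lie, so that restoring the minimum
changes nothing above `c_l`. -/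
theorem mem_colexBelow_succ_iff {j i : ℕ} (hj : 1 ≤ j) {c : ℕ → ℕ}
    (hc : ∀ l, j ≤ l → l < i → c l < c (l + 1)) {T : Finset (Fin n)} (hT : #T = i + 1) :
    T ∈ colexBelow (macaulaySet n j i c) (i + 1) ↔
      ∀ x ∈ T, T.erase x ∈ colexBelow (macaulaySet n j i c) i := by
  set A := macaulaySet n j i c with hA
  constructor
  · intro h x hx
    exact mem_colexBelow.2 ⟨by rw [card_erase_of_mem hx, hT, Nat.add_sub_cancel],
      (Colex.toColex_le_toColex_of_subset (erase_subset x T)).trans_lt (mem_colexBelow.1 h).2⟩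
  · intro h
    have hne : T.Nonempty := card_pos.1 (by omega)
    set x := T.min' hne with hx
    have hxT : x ∈ T := min'_mem _ _
    obtain ⟨hcard, hlt⟩ := mem_colexBelow.1 (h x hxT)
    obtain ⟨w, hw, hfil⟩ := Colex.lt_iff_exists_filter_lt.1 hlt
    obtain ⟨hwA, hwT⟩ := mem_sdiff.1 hw
    -- otherwise all `i` elements of `T.erase x` would lie above `w`, and would belong to `A`
    have hlow : ∃ b ∈ T.erase x, b ≤ w := by
      by_contra! hcon
      have h1 : {a ∈ T.erase x | w < a} = T.erase x := filter_true_of_mem hcon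
      have h2 := card_filter_macaulaySet_lt hj hc hwA
      rw [← hA, ← hfil, h1, hcard] at h2
      exact lt_irrefl _ h2
    obtain ⟨b, hb, hbw⟩ := hlow
    have hxw : x < w := by
      have h1 : x ≤ b := min'_le _ _ (mem_of_mem_erase hb)
      exact (lt_of_le_of_ne h1 (ne_of_mem_erase hb).symm).trans_le hbw
    refine mem_colexBelow.2 ⟨hT, Colex.lt_iff_exists_filter_lt.2 ⟨w, mem_sdiff.2 ⟨hwA, ?_⟩, ?_⟩⟩
    · exact fun hwT' => hwT (mem_erase.2 ⟨hxw.ne', hwT'⟩)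
    · rw [← hfil, filter_erase, erase_eq_of_notMem]
      simp [hxw.le]

/-- Initial segments are nested, so they are compared by counting. -/
theorem Finset.Colex.IsInitSeg.subset_of_card_le {𝒜 ℬ : Finset (Finset (Fin n))} {i : ℕ}
    (h𝒜 : Colex.IsInitSeg 𝒜 i) (hℬ : Colex.IsInitSeg ℬ i) (h : #𝒜 ≤ #ℬ) : 𝒜 ⊆ ℬ := by
  rcases h𝒜.total hℬ with h' | h'
  · exact h'
  · exact (eq_of_subset_of_card_le h' h).ge

/-- The colexicographic initial segment `𝒞` of `a` sets of size `i`, and the family `𝒰` of all sets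
of size `i + 1` whose `i`-element subsets lie in `𝒞`: the latter is again an initial segment, and
it has `a^{(i)}` members. -/
theorem exists_isInitSeg_upperShadow {a i : ℕ} (hi : 1 ≤ i) (ha : a ≤ n.choose i) :
    ∃ 𝒞 𝒰 : Finset (Finset (Fin n)), Colex.IsInitSeg 𝒞 i ∧ #𝒞 = a ∧ Colex.IsInitSeg 𝒰 (i + 1) ∧
      #𝒰 = macaulayShift a i ∧
      ∀ T : Finset (Fin n), #T = i + 1 → (T ∈ 𝒰 ↔ ∀ x ∈ T, T.erase x ∈ 𝒞) := by
  rcases Nat.eq_zero_or_pos a with rfl | hpos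
  · refine ⟨∅, ∅, Colex.isInitSeg_empty, rfl, Colex.isInitSeg_empty,
      by rw [macaulayShift_zero, card_empty], fun T hT => ?_⟩
    obtain ⟨x, hx⟩ : T.Nonempty := card_pos.1 (by omega)
    simp only [notMem_empty, false_iff]
    exact fun h => h x hx
  -- for `a = C(n, i)` the leading term `c_i = n` is outside `Fin n`, so this case is separate
  rcases Nat.eq_or_lt_of_le ha with rfl | hlt
  · have hin : i ≤ n := by
      by_contra h
      rw [Nat.choose_eq_zero_of_lt (by omega)] at hpos
      exact lt_irrefl _ hpos
    have hexp : IsMacaulayExpansion (n.choose i) i i (fun _ => n) :=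
      ⟨hi, le_rfl, hin, fun l h1 h2 => by omega, by simp⟩
    refine ⟨powersetCard i univ, powersetCard (i + 1) univ, ?_, by simp, ?_, ?_, ?_⟩
    · exact ⟨fun T hT => (mem_powersetCard.1 hT).2, fun T U _ hU => by simp [hU.2]⟩
    · exact ⟨fun T hT => (mem_powersetCard.1 hT).2, fun T U _ hU => by simp [hU.2]⟩
    · simp [hexp.macaulayShift_eq]
    · intro T hT
      simp only [mem_powersetCard, subset_univ, true_and, hT, true_iff]
      intro x hx
      rw [card_erase_of_mem hx, hT, Nat.add_sub_cancel]
  · obtain ⟨j, c, hc⟩ := exists_isMacaulayExpansion a i hpos hi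
    have hn : c i < n := by
      by_contra h
      have := Nat.choose_le_choose i (not_lt.1 h)
      have := hc.choose_le
      omega
    refine ⟨colexBelow (macaulaySet n j i c) i, colexBelow (macaulaySet n j i c) (i + 1),
      isInitSeg_colexBelow _ _, ?_, isInitSeg_colexBelow _ _, ?_,
      fun T hT => mem_colexBelow_succ_iff hc.one_le hc.lt_succ hT⟩
    · exact (card_colexBelow_macaulaySet hc.one_le 0 i hc.le hc.lt_succ hn).trans hc.eq_sum.symm
    · rw [hc.macaulayShift_eq]
      exact card_colexBelow_macaulaySet hc.one_le 1 i hc.le hc.lt_succ hn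

theorem card_le_choose_of_sized {𝒜 : Finset (Finset (Fin n))} {i : ℕ}
    (h : (𝒜 : Set (Finset (Fin n))).Sized i) : #𝒜 ≤ n.choose i := by
  simpa using h.card_le

/-- The Kruskal–Katona theorem in terms of `macaulayShift`. -/
theorem card_le_macaulayShift {𝒜 ℬ : Finset (Finset (Fin n))} {i : ℕ} (hi : 1 ≤ i)
    (h𝒜 : (𝒜 : Set (Finset (Fin n))).Sized (i + 1)) (hℬ : (ℬ : Set (Finset (Fin n))).Sized i)
    (h : ∀ T ∈ 𝒜, ∀ x ∈ T, T.erase x ∈ ℬ) : #𝒜 ≤ macaulayShift #ℬ i := by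
  obtain ⟨𝒞, 𝒰, h𝒞, h𝒞c, -, h𝒰c, hiff⟩ :=
    exists_isInitSeg_upperShadow hi (card_le_choose_of_sized hℬ)
  obtain ⟨𝒟, -, h𝒟, h𝒟c, -⟩ :=
    exists_isInitSeg_upperShadow (i := i + 1) (by omega) (card_le_choose_of_sized h𝒜)
  have hsh : #(shadow 𝒟) ≤ #𝒞 := by
    rw [h𝒞c]
    refine (kruskal_katona h𝒜 h𝒟c.le h𝒟).trans (card_le_card fun U hU => ?_)
    obtain ⟨T, hT, x, hx, rfl⟩ := mem_shadow_iff.1 hU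
    exact h T hT x hx
  have hsub : shadow 𝒟 ⊆ 𝒞 := Finset.Colex.IsInitSeg.subset_of_card_le h𝒟.shadow h𝒞 hsh
  rw [← h𝒟c, ← h𝒰c]
  exact card_le_card fun T hT => (hiff T (h𝒟.1 hT)).2 fun x hx =>
    hsub (mem_shadow_iff.2 ⟨T, hT, x, hx, rfl⟩)

/-- A sequence satisfying the Kruskal–Katona bounds is the face-counting sequence of a simplicial
complex, whose faces of each size form a colexicographic initial segment. -/
theorem exists_simplicialComplex {r : ℕ → ℕ} (hr : ∀ i, n < i → r i = 0) (h0 : r 0 = 1)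
    (h1 : r 1 ≤ n) (hs : ∀ i, 1 ≤ i → i < n → r (i + 1) ≤ macaulayShift (r i) i) :
    ∃ Δ : Set (Finset (Fin n)), (∀ T ∈ Δ, ∀ x ∈ T, T.erase x ∈ Δ) ∧
      ∀ i, Nat.card {T : {T : Finset (Fin n) // #T = i} // T.1 ∈ Δ} = r i := by
  have hchoose : ∀ i, 1 ≤ i → r i ≤ n.choose i := by
    intro i hi
    induction i, hi using Nat.le_induction with
    | base => simpa using h1
    | succ i hi ih =>
      rcases Nat.lt_or_ge i n with hin | hin
      · obtain ⟨-, 𝒰, -, -, h𝒰, h𝒰c, -⟩ := exists_isInitSeg_upperShadow hi ih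
        exact (hs i hi hin).trans (h𝒰c ▸ card_le_choose_of_sized h𝒰.1)
      · rw [hr (i + 1) (by omega)]
        exact Nat.zero_le _
  have hex : ∀ i, ∃ 𝒞 : Finset (Finset (Fin n)), Colex.IsInitSeg 𝒞 i ∧ #𝒞 = r i := by
    intro i
    rcases Nat.eq_zero_or_pos i with rfl | hi
    · exact ⟨{∅}, ⟨by simp [Set.Sized], by simp⟩, by simp [h0]⟩
    · obtain ⟨𝒞, -, h𝒞, hc, -⟩ := exists_isInitSeg_upperShadow hi (hchoose i hi)
      exact ⟨𝒞, h𝒞, hc⟩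
  choose 𝒞 h𝒞 hcard using hex
  have hmem : ∀ (i : ℕ) (T : Finset (Fin n)), #T = i → (T ∈ 𝒞 #T ↔ T ∈ 𝒞 i) := by
    rintro i T rfl
    rfl
  refine ⟨{T | T ∈ 𝒞 #T}, fun T hT x hx => ?_, fun i => ?_⟩
  · obtain ⟨i, hi⟩ : ∃ i, #T = i + 1 := ⟨#T - 1, by have := card_pos.2 ⟨x, hx⟩; omega⟩
    have hei : #(T.erase x) = i := by rw [card_erase_of_mem hx, hi, Nat.add_sub_cancel]
    rw [Set.mem_ofPred_eq, hmem _ _ hi] at hT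
    rw [Set.mem_ofPred_eq, hmem _ _ hei]
    rcases Nat.eq_zero_or_pos i with rfl | hipos
    · obtain ⟨U, hU⟩ : (𝒞 0).Nonempty := card_pos.1 (by rw [hcard, h0]; exact one_pos)
      rw [card_eq_zero.1 hei, ← card_eq_zero.1 ((h𝒞 0).1 hU)]
      exact hU
    · rcases Nat.lt_or_ge i n with hin | hin
      · obtain ⟨𝒞', 𝒰, h𝒞', h𝒞'c, h𝒰, h𝒰c, hiff⟩ :=
          exists_isInitSeg_upperShadow hipos (hchoose i hipos)
        have hTU : T ∈ 𝒰 := (h𝒞 (i + 1)).subset_of_card_le h𝒰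
          (by rw [hcard, h𝒰c]; exact hs i hipos hin) hT
        exact h𝒞'.subset_of_card_le (h𝒞 i) (by rw [hcard, h𝒞'c]) ((hiff T hi).1 hTU x hx)
      · have := card_pos.2 ⟨T, hT⟩
        rw [hcard, hr (i + 1) (by omega)] at this
        exact absurd this (lt_irrefl _)
  · rw [← hcard i, ← Nat.card_eq_finsetCard]
    exact Nat.card_congr
      { toFun := fun T => ⟨T.1.1, (hmem i _ T.1.2).1 T.2⟩
        invFun := fun T => ⟨⟨T.1, (h𝒞 i).1 T.2⟩, (hmem i _ ((h𝒞 i).1 T.2)).2 T.2⟩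
        left_inv := fun _ => rfl
        right_inv := fun _ => rfl }

end Colex

/-! ### Leading sets and contractions -/

section Leading

variable {k : Type u} [Field k] {n : ℕ}

/-- `T` is the colexicographically largest set in the support of `w`. -/
def IsLeadingSet {d : ℕ} (w : KoszulModule k n d) (T : {T : Finset (Fin n) // #T = d}) : Prop :=
  w T ≠ 0 ∧ ∀ U, w U ≠ 0 → toColex U.1 ≤ toColex T.1

theorem exists_isLeadingSet {d : ℕ} {w : KoszulModule k n d} (hw : w ≠ 0) :
    ∃ T, IsLeadingSet w T := by
  obtain ⟨T, hT, hmax⟩ := exists_max_image w.support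
    (fun U => toColex U.1) (Finsupp.support_nonempty_iff.2 hw)
  exact ⟨T, Finsupp.mem_support_iff.1 hT, fun U hU => hmax U (Finsupp.mem_support_iff.2 hU)⟩

/-- The leading sets of the nonzero elements of `W`. -/
noncomputable def leadingSets {d : ℕ} (W : Submodule k (KoszulModule k n d)) :
    Finset (Finset (Fin n)) :=
  open Classical in {T | ∃ h : #T = d, ∃ w ∈ W, IsLeadingSet w ⟨T, h⟩}

theorem mem_leadingSets {d : ℕ} {W : Submodule k (KoszulModule k n d)} {T : Finset (Fin n)} :
    T ∈ leadingSets W ↔ ∃ h : #T = d, ∃ w ∈ W, IsLeadingSet w ⟨T, h⟩ := by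
  simp [leadingSets]

theorem sized_leadingSets {d : ℕ} (W : Submodule k (KoszulModule k n d)) :
    (leadingSets W : Set (Finset (Fin n))).Sized d :=
  fun _ hT => (mem_leadingSets.1 hT).1

/-- Elements with distinct leading sets are linearly independent, and an element of `W` is
determined by its coefficients at the leading sets of `W`. -/
theorem card_leadingSets {d : ℕ} (W : Submodule k (KoszulModule k n d)) :
    #(leadingSets W) = Module.finrank k W := by
  classical
  have hsp : ∀ T : leadingSets W, ∃ w : W, IsLeadingSet w.1 ⟨T.1, sized_leadingSets W T.2⟩ := by
    intro T
    obtain ⟨h, w, hw, hl⟩ := mem_leadingSets.1 T.2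
    exact ⟨⟨w, hw⟩, hl⟩
  choose w hw using hsp
  apply le_antisymm
  · have hli : LinearIndependent k w := by
      apply LinearIndependent.of_comp W.subtype
      rw [Fintype.linearIndependent_iff]
      intro g hg
      by_contra! hcon
      obtain ⟨T₀, hT₀⟩ := hcon
      obtain ⟨T, hT, hmax⟩ := exists_max_image ({T | g T ≠ 0} : Finset (leadingSets W))
        (fun U => toColex U.1) ⟨T₀, by simpa using hT₀⟩
      have hT' : g T ≠ 0 := by simpa using hT
      have h1 := DFunLike.congr_fun hg ⟨T.1, sized_leadingSets W T.2⟩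
      simp only [Finsupp.coe_finsetSum, Finset.sum_apply, Finsupp.smul_apply, smul_eq_mul,
        Function.comp_apply, Submodule.subtype_apply, Finsupp.coe_zero, Pi.zero_apply] at h1
      rw [Finset.sum_eq_single T] at h1
      · exact (mul_ne_zero hT' (hw T).1) h1
      · intro U _ hUT
        by_contra hne
        have hgU : g U ≠ 0 := left_ne_zero_of_mul hne
        have hle := hmax U (by simpa using hgU)
        have hle' := (hw U).2 _ (right_ne_zero_of_mul hne)
        exact hUT (Subtype.ext (toColex_inj.1 (le_antisymm hle hle')))
      · exact fun h => absurd (mem_univ T) h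
    simpa using hli.fintype_card_le_finrank
  · let f : W →ₗ[k] (leadingSets W → k) :=
      LinearMap.pi fun T => Finsupp.lapply ⟨T.1, sized_leadingSets W T.2⟩ ∘ₗ W.subtype
    have hf : Function.Injective f := by
      rw [injective_iff_map_eq_zero]
      intro x hx
      by_contra hne
      obtain ⟨T, hT⟩ := exists_isLeadingSet (w := x.1) (by simpa using hne)
      have hmem : T.1 ∈ leadingSets W := mem_leadingSets.2 ⟨T.2, x.1, x.2, hT⟩
      exact hT.1 (congrFun hx ⟨T.1, hmem⟩)
    simpa using LinearMap.finrank_le_finrank_of_injective hf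

/-- The Koszul differential with `f = δ_x` is contraction with the dual vector of `e_x`. -/
theorem koszulD_single_apply {d : ℕ} (x : Fin n) (w : KoszulModule k n (d + 1))
    (U : {T : Finset (Fin n) // #T = d}) :
    koszulD (Pi.single x (1 : k)) d w U = if h : x ∈ U.1 then 0 else
      (-1) ^ position (insert x U.1) x *
        w ⟨insert x U.1, by rw [card_insert_of_notMem h, U.2]⟩ := by
  induction w using Finsupp.induction_linear with
  | zero => simp
  | add f g hf hg =>
    rw [map_add, Finsupp.add_apply, hf, hg]
    split_ifs
    · simp
    · rw [Finsupp.add_apply, mul_add]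
  | single T c =>
    simp only [koszulD, Finsupp.linearCombination_single, Finsupp.smul_apply,
      Finsupp.coe_finsetSum, Finset.sum_apply, smul_eq_mul]
    by_cases hxT : x ∈ T.1
    · rw [Finset.sum_eq_single ⟨x, hxT⟩]
      · rw [Pi.single_eq_same, mul_one]
        by_cases hU : eraseSubset T ⟨x, hxT⟩ = U
        · subst hU
          have hxe : x ∉ T.1.erase x := notMem_erase x _
          have he : insert x (T.1.erase x) = T.1 := insert_erase hxT
          simp [eraseSubset, he, mul_comm]
        · rw [Finsupp.single_eq_of_ne' hU, mul_zero]
          split_ifs with h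
          · rfl
          · rw [Finsupp.single_eq_of_ne', mul_zero]
            rintro rfl
            exact hU (Subtype.ext (erase_insert h))
      · intro a _ hax
        have : (a : Fin n) ≠ x := fun h => hax (Subtype.ext h)
        simp [this]
      · exact fun h => absurd (mem_univ _) h
    · rw [Finset.sum_eq_zero]
      · rw [mul_zero]
        split_ifs with h
        · rfl
        · rw [Finsupp.single_eq_of_ne', mul_zero]
          rintro rfl
          exact hxT (mem_insert_self _ _)
      · intro a _
        have : (a : Fin n) ≠ x := fun h => hxT (h ▸ a.2)
        simp [this]

/-- Contraction removes `x` from the leading set, as removing a common element from two sets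
preserves their colexicographic order. -/
theorem IsLeadingSet.koszulD_single {d : ℕ} {w : KoszulModule k n (d + 1)}
    {T : {T : Finset (Fin n) // #T = d + 1}} (h : IsLeadingSet w T) (x : T.1) :
    IsLeadingSet (koszulD (Pi.single x.1 (1 : k)) d w) (eraseSubset T x) := by
  have hx : x.1 ∉ (eraseSubset T x).1 := notMem_erase _ _
  have he : insert x.1 (eraseSubset T x).1 = T.1 := insert_erase x.2
  constructor
  · rw [koszulD_single_apply, dif_neg hx]
    refine mul_ne_zero (pow_ne_zero _ (neg_ne_zero.2 one_ne_zero)) ?_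
    convert h.1 using 2
    exact Subtype.ext he
  · intro U hU
    rw [koszulD_single_apply] at hU
    split_ifs at hU with hxU
    · exact absurd rfl hU
    · have hle : toColex (insert x.1 U.1) ≤ toColex (insert x.1 (eraseSubset T x).1) := by
        rw [he]
        exact h.2 _ (right_ne_zero_of_mul hU)
      have := (Colex.toColex_sdiff_le_toColex_sdiff (s := insert x.1 U.1)
        (t := insert x.1 (eraseSubset T x).1) (u := {x.1}) (by simp) (by simp)).2 hle
      rwa [sdiff_singleton_eq_erase, sdiff_singleton_eq_erase, erase_insert hxU,
        erase_insert hx] at this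

theorem erase_mem_leadingSets {d : ℕ} {W : Submodule k (KoszulModule k n (d + 1))}
    {W' : Submodule k (KoszulModule k n d)}
    (hW : ∀ w ∈ W, ∀ x, koszulD (Pi.single x (1 : k)) d w ∈ W') {T : Finset (Fin n)}
    (hT : T ∈ leadingSets W) {x : Fin n} (hx : x ∈ T) : T.erase x ∈ leadingSets W' := by
  obtain ⟨h, w, hw, hl⟩ := mem_leadingSets.1 hT
  exact mem_leadingSets.2 ⟨_, _, hW w hw x, hl.koszulD_single ⟨x, hx⟩⟩

end Leading

/-! ### Reduction of a subcomplex modulo the variables -/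

section Reduction

open MvPolynomial

variable {k : Type u} [Field k] {n : ℕ}

/-- The coefficientwise evaluation at the origin `K_d → K_d / (x_1, …, x_n) K_d`. -/
noncomputable def koszulEval (k : Type u) [Field k] (n d : ℕ) :
    KoszulModule (MvPolynomial (Fin n) k) n d →ₛₗ[(constantCoeff : MvPolynomial (Fin n) k →+* k)]
      KoszulModule k n d where
  toFun z := z.mapRange constantCoeff (map_zero _)
  map_add' z z' := Finsupp.mapRange_add (map_add _) z z'
  map_smul' p z := by
    ext T
    simp

@[simp]
theorem koszulEval_apply {d : ℕ} (z : KoszulModule (MvPolynomial (Fin n) k) n d) (T) :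
    koszulEval k n d z T = constantCoeff (z T) := by
  simp [koszulEval]

/-- The coefficientwise coefficient of `x` in the linear part of `z`. -/
noncomputable def koszulLinearCoeff (k : Type u) [Field k] (n d : ℕ) (x : Fin n) :
    KoszulModule (MvPolynomial (Fin n) k) n d →+ KoszulModule k n d :=
  Finsupp.mapRange.addMonoidHom
    ((constantCoeff : MvPolynomial (Fin n) k →+* k).toAddMonoidHom.comp
      (pderiv x : Derivation k _ _).toLinearMap.toAddMonoidHom)

@[simp]
theorem koszulLinearCoeff_apply {d : ℕ} (x : Fin n)
    (z : KoszulModule (MvPolynomial (Fin n) k) n d) (T) :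
    koszulLinearCoeff k n d x z T = constantCoeff (pderiv x (z T)) := by
  simp [koszulLinearCoeff]

theorem koszulLinearCoeff_smul {d : ℕ} (x : Fin n) (p : MvPolynomial (Fin n) k)
    (z : KoszulModule (MvPolynomial (Fin n) k) n d) :
    koszulLinearCoeff k n d x (p • z) =
      constantCoeff p • koszulLinearCoeff k n d x z +
        constantCoeff (pderiv x p) • koszulEval k n d z := by
  ext T
  simp
  ring

/-- The linear part of the Koszul differential is contraction. -/
theorem koszulLinearCoeff_koszulD {d : ℕ} (x : Fin n)
    (z : KoszulModule (MvPolynomial (Fin n) k) n (d + 1)) :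
    koszulLinearCoeff k n d x (koszulD (fun i => X i) d z) =
      koszulD (Pi.single x (1 : k)) d (koszulEval k n (d + 1) z) := by
  induction z using Finsupp.induction_linear with
  | zero => simp
  | add f g hf hg => simp only [map_add, hf, hg]
  | single T p =>
    have h1 : koszulEval k n (d + 1) (Finsupp.single T p) =
        Finsupp.single T (constantCoeff p) :=
      Finsupp.mapRange_single (hf := map_zero _)
    rw [h1]
    simp only [koszulD, Finsupp.linearCombination_single, map_sum, Finset.smul_sum]
    refine Finset.sum_congr rfl fun a _ => ?_
    ext U
    by_cases hU : eraseSubset T a = U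
    · subst hU
      by_cases hax : (a : Fin n) = x
      · subst hax
        rcases Nat.even_or_odd (position T.1 a) with h | h <;> simp [h.neg_one_pow]
      · rcases Nat.even_or_odd (position T.1 a) with h | h <;>
          simp [h.neg_one_pow, pderiv_X, hax]
    · simp [Finsupp.single_eq_of_ne' hU]

theorem constantCoeff_koszulD {d : ℕ} (z : KoszulModule (MvPolynomial (Fin n) k) n (d + 1)) (U) :
    constantCoeff (koszulD (fun i => (X i : MvPolynomial (Fin n) k)) d z U) = 0 := by
  rw [← koszulEval_apply]
  induction z using Finsupp.induction_linear with
  | zero => simp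
  | add f g hf hg => rw [map_add, map_add, Finsupp.add_apply, hf, hg, add_zero]
  | single T p =>
    simp only [koszulD, Finsupp.linearCombination_single, koszulEval_apply, Finsupp.smul_apply,
      Finsupp.coe_finsetSum, Finset.sum_apply, smul_eq_mul, map_mul, map_sum]
    refine mul_eq_zero_of_right _ (Finset.sum_eq_zero fun a _ => ?_)
    by_cases hU : eraseSubset T a = U
    · subst hU
      simp
    · simp [Finsupp.single_eq_of_ne' hU]

variable {F G : Type u} [AddCommGroup F] [Module (MvPolynomial (Fin n) k) F]
  [AddCommGroup G] [Module (MvPolynomial (Fin n) k) G]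

/-- The image of `F` in `K_d / (x_1, …, x_n) K_d`. -/
noncomputable def reducedRange {d : ℕ}
    (φ : F →ₗ[MvPolynomial (Fin n) k] KoszulModule (MvPolynomial (Fin n) k) n d) :
    Submodule k (KoszulModule k n d) :=
  have : RingHomSurjective (constantCoeff : MvPolynomial (Fin n) k →+* k) :=
    ⟨fun c => ⟨C c, constantCoeff_C (Fin n) c⟩⟩
  (LinearMap.range φ).map (koszulEval k n d)

theorem mem_reducedRange {d : ℕ}
    {φ : F →ₗ[MvPolynomial (Fin n) k] KoszulModule (MvPolynomial (Fin n) k) n d}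
    {w : KoszulModule k n d} : w ∈ reducedRange φ ↔ ∃ y, koszulEval k n d (φ y) = w := by
  simp [reducedRange]

/-- A split injection stays injective modulo the variables, so reduction preserves the rank. -/
theorem rank_reducedRange {d : ℕ} [Module.Free (MvPolynomial (Fin n) k) F]
    {φ : F →ₗ[MvPolynomial (Fin n) k] KoszulModule (MvPolynomial (Fin n) k) n d}
    {σ : KoszulModule (MvPolynomial (Fin n) k) n d →ₗ[MvPolynomial (Fin n) k] F}
    (hσ : σ ∘ₗ φ = LinearMap.id) :
    Module.rank k (reducedRange φ) = Module.rank (MvPolynomial (Fin n) k) F := by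
  have hσ' : ∀ y, σ (φ y) = y := fun y => LinearMap.congr_fun hσ y
  let b := Module.Free.chooseBasis (MvPolynomial (Fin n) k) F
  have hli : LinearIndependent k fun j => koszulEval k n d (φ (b j)) := by
    rw [linearIndependent_iff']
    intro s g hg j hj
    set y : F := ∑ i ∈ s, (C (g i) : MvPolynomial (Fin n) k) • b i with hy
    have hz : koszulEval k n d (φ y) = 0 := by
      rw [hy, map_sum, map_sum, ← hg]
      refine Finset.sum_congr rfl fun i _ => ?_
      rw [map_smul, LinearMap.map_smulₛₗ, constantCoeff_C]
    have h1 : y = ∑ T, φ y T • σ (Finsupp.single T 1) := by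
      conv_lhs => rw [← hσ' y, ← Finsupp.univ_sum_single (φ y)]
      rw [map_sum]
      refine Finset.sum_congr rfl fun T _ => ?_
      rw [← map_smul, Finsupp.smul_single, smul_eq_mul, mul_one]
    -- applying `σ` to `φ y`, whose coordinates vanish at the origin, recovers `y`
    have h2 : constantCoeff (b.repr y j) = 0 := by
      rw [h1, map_sum, Finsupp.coe_finsetSum, Finset.sum_apply, map_sum]
      refine Finset.sum_eq_zero fun T _ => ?_
      rw [map_smul, Finsupp.smul_apply, smul_eq_mul, map_mul, ← koszulEval_apply, hz,
        Finsupp.zero_apply, zero_mul]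
    have h3 : b.repr y j = C (g j) := by
      classical
      rw [hy, map_sum, Finsupp.coe_finsetSum, Finset.sum_apply]
      simp [Finsupp.single_apply, hj]
    rw [h3, constantCoeff_C] at h2
    exact h2
  have hspan : reducedRange φ =
      Submodule.span k (Set.range fun j => koszulEval k n d (φ (b j))) := by
    apply le_antisymm
    · intro w hw
      obtain ⟨y, rfl⟩ := mem_reducedRange.1 hw
      induction b.mem_span y using Submodule.span_induction with
      | mem y hy =>
        obtain ⟨j, rfl⟩ := hy
        exact Submodule.subset_span ⟨j, rfl⟩
      | zero => simp
      | add y y' _ _ h h' =>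
        rw [map_add, map_add]
        exact add_mem (h (mem_reducedRange.2 ⟨_, rfl⟩)) (h' (mem_reducedRange.2 ⟨_, rfl⟩))
      | smul p y _ h =>
        rw [map_smul, LinearMap.map_smulₛₗ]
        exact Submodule.smul_mem _ _ (h (mem_reducedRange.2 ⟨_, rfl⟩))
    · rw [Submodule.span_le]
      rintro _ ⟨j, rfl⟩
      exact mem_reducedRange.2 ⟨_, rfl⟩
  rw [hspan, rank_span hli, Cardinal.mk_range_eq _ hli.injective, b.mk_eq_rank'']

/-- Contraction maps the reduction of `F` into the reduction of `G`: the Koszul differential of an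
element of `ψ(F)` lies in `(x_1, …, x_n) K_d ∩ φ(G)`, which is `(x_1, …, x_n) φ(G)` because `φ`
splits, and the linear part of an element of the latter has its coefficients in the reduction of
`G`. -/
theorem koszulD_single_mem_reducedRange {d : ℕ}
    {ψ : F →ₗ[MvPolynomial (Fin n) k] KoszulModule (MvPolynomial (Fin n) k) n (d + 1)}
    {φ : G →ₗ[MvPolynomial (Fin n) k] KoszulModule (MvPolynomial (Fin n) k) n d}
    {σ : KoszulModule (MvPolynomial (Fin n) k) n d →ₗ[MvPolynomial (Fin n) k] G}
    (hσ : σ ∘ₗ φ = LinearMap.id) {δ : F →ₗ[MvPolynomial (Fin n) k] G}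
    (hδ : φ ∘ₗ δ = koszulD (fun i => X i) d ∘ₗ ψ) (x : Fin n) :
    ∀ w ∈ reducedRange ψ, koszulD (Pi.single x (1 : k)) d w ∈ reducedRange φ := by
  intro w hw
  obtain ⟨y, rfl⟩ := mem_reducedRange.1 hw
  rw [← koszulLinearCoeff_koszulD]
  have hy : φ (δ y) = koszulD (fun i => X i) d (ψ y) := LinearMap.congr_fun hδ y
  have h1 : δ y = ∑ T, φ (δ y) T • σ (Finsupp.single T 1) := by
    have : σ (φ (δ y)) = δ y := LinearMap.congr_fun hσ _
    conv_lhs => rw [← this, ← Finsupp.univ_sum_single (φ (δ y))]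
    rw [map_sum]
    refine Finset.sum_congr rfl fun T _ => ?_
    rw [← map_smul, Finsupp.smul_single, smul_eq_mul, mul_one]
  rw [← hy, h1, map_sum, map_sum]
  refine Submodule.sum_mem _ fun T _ => ?_
  rw [map_smul, koszulLinearCoeff_smul, hy, constantCoeff_koszulD, zero_smul, zero_add]
  exact Submodule.smul_mem _ _ (mem_reducedRange.2 ⟨_, rfl⟩)

end Reduction

/-! ### The subcomplex of a simplicial complex -/

section FaceComplex

variable {R : Type u} [CommRing R] {m : ℕ}

/-- The free submodule of `K_d` with basis `e_T`, where `T` runs over the `d`-element members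
of `Δ`. -/
abbrev faceModule (R : Type u) [CommRing R] (Δ : Set (Finset (Fin m))) (d : ℕ) :
    Submodule R (KoszulModule R m d) :=
  Finsupp.supported R R {T | T.1 ∈ Δ}

theorem koszulD_mem_faceModule {Δ : Set (Finset (Fin m))}
    (hΔ : ∀ T ∈ Δ, ∀ x ∈ T, T.erase x ∈ Δ) (f : Fin m → R) (d : ℕ) :
    ∀ z ∈ faceModule R Δ (d + 1), koszulD f d z ∈ faceModule R Δ d := by
  intro z hz
  rw [koszulD, Finsupp.linearCombination_apply]
  refine Submodule.sum_mem _ fun T hT => Submodule.smul_mem _ _ (Submodule.sum_mem _ fun a _ => ?_)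
  exact Finsupp.single_mem_supported R _ (hΔ T.1 (hz hT) a a.2)

/-- The subcomplex of the Koszul complex spanned by the faces of a simplicial complex `Δ`. -/
noncomputable def faceComplex {Δ : Set (Finset (Fin m))}
    (hΔ : ∀ T ∈ Δ, ∀ x ∈ T, T.erase x ∈ Δ) (f : Fin m → R) : ChainComplex (ModuleCat.{u} R) ℕ :=
  ChainComplex.of (fun d => ModuleCat.of R (faceModule R Δ d))
    (fun d => ModuleCat.ofHom ((koszulD f d).restrict (koszulD_mem_faceModule hΔ f d)))
    (fun d => by
      rw [← ModuleCat.ofHom_comp]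
      refine congrArg ModuleCat.ofHom (LinearMap.ext fun z => Subtype.ext ?_)
      exact LinearMap.congr_fun (koszulD_comp f d) z.1)

theorem faceComplex_d {Δ : Set (Finset (Fin m))}
    (hΔ : ∀ T ∈ Δ, ∀ x ∈ T, T.erase x ∈ Δ) (f : Fin m → R) (d : ℕ) :
    (faceComplex hΔ f).d (d + 1) d =
      ModuleCat.ofHom ((koszulD f d).restrict (koszulD_mem_faceModule hΔ f d)) :=
  ChainComplex.of_d (fun d => ModuleCat.of R (faceModule R Δ d))
    (fun d => ModuleCat.ofHom ((koszulD f d).restrict (koszulD_mem_faceModule hΔ f d))) d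

/-- The inclusion of the subcomplex spanned by the faces of `Δ`. -/
noncomputable def faceInclusion {Δ : Set (Finset (Fin m))}
    (hΔ : ∀ T ∈ Δ, ∀ x ∈ T, T.erase x ∈ Δ) (f : Fin m → R) :
    faceComplex hΔ f ⟶ koszulComplex f :=
  ChainComplex.ofHom (fun d => ModuleCat.ofHom (faceModule R Δ d).subtype)
    (fun d => by
      rw [koszulComplex_d, faceComplex_d]
      rfl)

/-- The basis `e_T` of the module spanned by the `d`-element faces. -/
noncomputable def faceBasis (Δ : Set (Finset (Fin m))) (d : ℕ) :
    Module.Basis {T : {T : Finset (Fin m) // #T = d} // T.1 ∈ Δ} R (faceModule R Δ d) :=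
  ⟨Finsupp.supportedEquivFinsupp {T : {T : Finset (Fin m) // #T = d} | T.1 ∈ Δ}⟩

theorem coe_faceBasis (Δ : Set (Finset (Fin m))) (d : ℕ)
    (T : {T : {T : Finset (Fin m) // #T = d} // T.1 ∈ Δ}) :
    (faceBasis (R := R) Δ d T : KoszulModule R m d) = Finsupp.single T.1 1 := by
  exact Finsupp.supportedEquivFinsupp_symm_single
    (R := R) {T : {T : Finset (Fin m) // #T = d} | T.1 ∈ Δ} T (1 : R)

theorem isSubcomplexVia_faceInclusion {Δ : Set (Finset (Fin m))}
    (hΔ : ∀ T ∈ Δ, ∀ x ∈ T, T.erase x ∈ Δ) (f : Fin m → R) :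
    IsSubcomplexVia (faceInclusion hΔ f) where
  free d := Module.Free.of_basis (faceBasis (R := R) Δ d)
  split d := by
    classical
    refine ⟨ModuleCat.ofHom
      (Finsupp.restrictDom R R {T : {T : Finset (Fin m) // #T = d} | T.1 ∈ Δ}), ?_⟩
    ext z
    exact LinearMap.congr_fun (Finsupp.restrictDom_comp_subtype _) z

theorem isRankSequence_faceComplex [Nontrivial R] {Δ : Set (Finset (Fin m))}
    (hΔ : ∀ T ∈ Δ, ∀ x ∈ T, T.erase x ∈ Δ) (f : Fin m → R) {r : ℕ → ℕ}
    (hr : ∀ d, Nat.card {T : {T : Finset (Fin m) // #T = d} // T.1 ∈ Δ} = r d) :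
    IsRankSequence (faceComplex hΔ f) r := by
  intro d
  classical
  have h := rank_eq_card_basis (faceBasis (R := R) Δ d)
  rw [← hr d, Nat.card_eq_fintype_card]
  exact h

theorem isGradedVia_faceInclusion {k : Type u} [Field k] {Δ : Set (Finset (Fin m))}
    (hΔ : ∀ T ∈ Δ, ∀ x ∈ T, T.erase x ∈ Δ) :
    IsGradedVia (k := k) (faceInclusion hΔ fun i => MvPolynomial.X i) := by
  intro d
  refine ⟨_, faceBasis Δ d, fun _ => d, fun T U hU => ⟨0, zero_add d, ?_⟩⟩
  change MvPolynomial.IsHomogeneous ((faceBasis (R := MvPolynomial (Fin m) k) Δ d T).1 U) 0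
  rw [coe_faceBasis]
  by_cases hTU : T.1 = U
  · rw [hTU, Finsupp.single_eq_same]
    exact MvPolynomial.isHomogeneous_one _ _
  · rw [Finsupp.single_eq_of_ne' hTU]
    exact MvPolynomial.isHomogeneous_zero _ _ _

end FaceComplex

/-! ### Rank sequences of subcomplexes of the Koszul complex -/

section RankSequences

variable {k : Type u} [Field k] {n : ℕ}

theorem gradedKoszulRS_subset_RS : gradedKoszulRS k n ⊆ RS (koszulVariables k n) :=
  fun _ ⟨F, φ, hφ, _, hr⟩ => ⟨F, φ, hφ, hr⟩

theorem mem_gradedKoszulRS_of_simplicialComplex {Δ : Set (Finset (Fin n))}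
    (hΔ : ∀ T ∈ Δ, ∀ x ∈ T, T.erase x ∈ Δ) {r : ℕ → ℕ}
    (hr : ∀ d, Nat.card {T : {T : Finset (Fin n) // #T = d} // T.1 ∈ Δ} = r d) :
    r ∈ gradedKoszulRS k n :=
  ⟨faceComplex hΔ _, faceInclusion hΔ _, isSubcomplexVia_faceInclusion hΔ _,
    isGradedVia_faceInclusion hΔ, isRankSequence_faceComplex hΔ _ hr⟩

/-- The rank sequence of a subcomplex counts the faces of a simplicial complex, formed by the
leading sets of the reduction of the subcomplex. -/
theorem exists_faces_of_mem_RS {r : ℕ → ℕ} (h : r ∈ RS (koszulVariables k n)) :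
    ∃ L : ℕ → Finset (Finset (Fin n)), (∀ d, (L d : Set (Finset (Fin n))).Sized d) ∧
      (∀ d, #(L d) = r d) ∧ ∀ d, ∀ T ∈ L (d + 1), ∀ x ∈ T, T.erase x ∈ L d := by
  obtain ⟨F, φ, hφ, hr⟩ := h
  let ψ : ∀ d, F.X d →ₗ[MvPolynomial (Fin n) k] KoszulModule (MvPolynomial (Fin n) k) n d :=
    fun d => (φ.f d).hom
  have hsplit : ∀ d, ∃ σ : KoszulModule (MvPolynomial (Fin n) k) n d →ₗ[MvPolynomial (Fin n) k]
      F.X d, σ ∘ₗ ψ d = LinearMap.id := by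
    intro d
    obtain ⟨σ, hσ⟩ := hφ.split d
    exact ⟨σ.hom, congrArg ModuleCat.Hom.hom hσ⟩
  choose σ hσ using hsplit
  have hcomm : ∀ d, ψ d ∘ₗ (F.d (d + 1) d).hom =
      koszulD (fun i => MvPolynomial.X i) d ∘ₗ ψ (d + 1) := by
    intro d
    have h := φ.comm (d + 1) d
    rw [koszulComplex_d] at h
    exact (congrArg ModuleCat.Hom.hom h).symm
  refine ⟨fun d => leadingSets (reducedRange (ψ d)), fun d => sized_leadingSets _, fun d => ?_,
    fun d T hT x hx => erase_mem_leadingSets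
      (fun w hw x => koszulD_single_mem_reducedRange (hσ d) (hcomm d) x w hw) hT hx⟩
  have := hφ.free d
  rw [card_leadingSets, Module.finrank, rank_reducedRange (hσ d), hr d, Cardinal.toNat_natCast]

theorem bounds_of_mem_RS {r : ℕ → ℕ} (h : r ∈ RS (koszulVariables k n)) :
    (∀ i, r i = 0) ∨
      (r 0 = 1 ∧ r 1 ≤ n ∧ ∀ i, 1 ≤ i → i < n → r (i + 1) ≤ macaulayShift (r i) i) := by
  obtain ⟨L, hL, hcard, herase⟩ := exists_faces_of_mem_RS h
  have h0 : r 0 ≤ 1 := by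
    simpa [hcard] using card_le_choose_of_sized (hL 0)
  rcases Nat.eq_zero_or_pos (r 0) with hz | hpos
  · left
    intro i
    induction i with
    | zero => exact hz
    | succ i ih =>
      rw [← hcard, card_eq_zero, eq_empty_iff_forall_notMem] at ih ⊢
      intro T hT
      obtain ⟨x, hx⟩ : T.Nonempty := card_pos.1 (by rw [hL _ hT]; omega)
      exact ih _ (herase i T hT x hx)
  · refine Or.inr ⟨le_antisymm h0 hpos, ?_, fun i hi _ => ?_⟩
    · simpa [hcard] using card_le_choose_of_sized (hL 1)
    · simpa only [hcard] using card_le_macaulayShift hi (hL (i + 1)) (hL i) (herase i)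

theorem mem_gradedKoszulRS_of_bounds {r : ℕ → ℕ} (hr : ∀ i, n < i → r i = 0)
    (h : (∀ i, r i = 0) ∨
      (r 0 = 1 ∧ r 1 ≤ n ∧ ∀ i, 1 ≤ i → i < n → r (i + 1) ≤ macaulayShift (r i) i)) :
    r ∈ gradedKoszulRS k n := by
  rcases h with h | ⟨h0, h1, h⟩
  · exact mem_gradedKoszulRS_of_simplicialComplex (Δ := ∅) (by simp) (by simp [h])
  · obtain ⟨Δ, hΔ, hcard⟩ := exists_simplicialComplex hr h0 h1 h
    exact mem_gradedKoszulRS_of_simplicialComplex hΔ hcard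

end RankSequences

theorem mainTheorem2 {k : Type u} [Field k] (n : ℕ) (r : ℕ → ℕ) (hr : ∀ i, n < i → r i = 0) :
    (r ∈ RS (koszulVariables k n) ↔
      (∀ i, r i = 0) ∨
        (r 0 = 1 ∧ r 1 ≤ n ∧ ∀ i, 1 ≤ i → i < n → r (i + 1) ≤ macaulayShift (r i) i)) ∧
    (r ∈ gradedKoszulRS k n ↔
      (∀ i, r i = 0) ∨
        (r 0 = 1 ∧ r 1 ≤ n ∧ ∀ i, 1 ≤ i → i < n → r (i + 1) ≤ macaulayShift (r i) i)) :=
  ⟨⟨bounds_of_mem_RS, fun h => gradedKoszulRS_subset_RS (mem_gradedKoszulRS_of_bounds hr h)⟩,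
    ⟨fun h => bounds_of_mem_RS (gradedKoszulRS_subset_RS h), mem_gradedKoszulRS_of_bounds hr⟩⟩
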